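/- Let $\Omega$ be the unit disk $\mathbb D$ with $g$ mutually disjoint closed disks $\{|z-q_j|\le r_j\}\subset\mathbb D$ ($r_j>0$, $j=1,\dots,g$) removed. Put $\gamma_0=\partial\mathbb D$, $\gamma_j=\{|z-q_j|=r_j\}$, let $\varphi_0(z)=1/\overline z$ and $\varphi_j(z)=q_j+r_j^2/(\overline z-\overline{q_j})$ be the reflections of the Riemann sphere in $\gamma_0$ and $\gamma_j$, and let $\theta_j=\varphi_j\circ\varphi_0$. Let $\Theta$ be the (Schottky) group of Möbius transformations of the sphere generated by $\theta_1,\dots,\theta_g$, let $\Omega^*=\Omega\cup\gamma_0\cup\varphi_0(\Omega)$, and let $U$ be the set of finite points of $\bigcup_{\theta\in\Theta}\theta(\overline{\Omega^*})$. Let $v_1,\dots,v_g$ be the integrals of the first kind: holomorphic functions on $U$, many-valued up to integers, with $\oint_{\gamma_i}dv_j=\delta_{ij}$ and $v_j(\theta_i(z))-v_j(z)=\tau_{ij}$ (modulo integers) for purely imaginary constants $\tau_{ij}$. Let $\omega(z,y)$ ($z\in U$, $y\in\Omega^*\setminus\{\infty\}$) be the Schottky–Klein prime function of $\Omega$: $\omega(\cdot,y)$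 is analytic on $U$, has a simple zero at each finite point $\theta(y)$, $\theta\in\Theta$, and no other zeros, satisfies $\lim_{z\to y}\omega(z,y)/(z-y)=1$, and, for a suitable holomorphic branch of the square root and all $z\in U$ with $\theta_j(z)\ne\infty$, $$\omega(\theta_j(z),y)=\exp\bigl(2\pi i(v_j(y)-v_j(z))-\pi i\tau_{jj}\bigr)\sqrt{\tfrac{d\theta_j}{dz}(z)}\;\omega(z,y),\qquad j=1,\dots,g.$$ Let $\Theta'$ be a maximal subset of $\Theta$ that does not contain the identity and is such that $\theta^{-1}\notin\Theta'$ whenever $\theta\in\Theta'$. Suppose that $\omega$ has the infinite product form $$\omega(z,y)=(z-y)\prod_{\theta\in\Theta'}\frac{(z-\theta(y))(y-\theta(z))}{(z-\theta(z))(y-\theta(y))}$$ for all finite $z,y\in\Omega^*$, the product being unconditionally convergent. For $p\in\Omega\setminus\{0\}$ put $$\eta(z,p)=\frac{\omega(z,p)}{|p|\,\omega(z,\overline p^{\,-1})},\qquad m(z,p)=\frac{z-p}{1-\overline p z},\quad m(\infty,p)=-\frac1{\overline p}.$$ Then $|\eta(1,p)|=1$, and for every $z\in\Omega$ the product below converges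 unconditionally and $$\frac{\eta(z,p)}{\eta(1,p)}=\prod_{\theta\in\Theta}\frac{m(\theta(z),p)}{m(\theta(1),p)}.$$ That is, $\eta(\cdot,p)$, rotated so that its value at $1$ is $1$, equals the product. (In quotients, a pair of factors $(z-\infty)/(y-\infty)$ is read as $1$.) -/

import Mathlib

open Complex ComplexConjugate Topology Filter

noncomputable section

/-- Reflection of the Riemann sphere `ℂ ∪ {∞}` in the circle with centre `q` and radius `r`:
`z ↦ q + r ^ 2 / conj (z - q)`, interchanging `q` and `∞`. -/
def reflFun (q : ℂ) (r : ℝ) : OnePoint ℂ → OnePoint ℂ := fun x =>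
  x.elim (q : OnePoint ℂ) fun z =>
    if z = q then OnePoint.infty else ((q + (r : ℂ) ^ 2 / conj (z - q) : ℂ) : OnePoint ℂ)

theorem reflFun_involutive (q : ℂ) (r : ℝ) (hr : r ≠ 0) :
    Function.Involutive (reflFun q r) := by
  have hr' : (r : ℂ) ≠ 0 := by exact_mod_cast hr
  intro x
  induction x using OnePoint.rec with
  | infty => simp [reflFun]
  | coe z =>
    by_cases h : z = q
    · simp [reflFun, h]
    · have h1 : z - q ≠ 0 := sub_ne_zero.2 h
      have h2 : conj (z - q) ≠ 0 := (map_ne_zero (starRingEnd ℂ)).2 h1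
      have h3 : (r : ℂ) ^ 2 / conj (z - q) ≠ 0 := div_ne_zero (pow_ne_zero _ hr') h2
      have h4 : q + (r : ℂ) ^ 2 / conj (z - q) ≠ q := by
        intro h5
        exact h3 (by linear_combination h5)
      simp only [reflFun, OnePoint.elim_some, if_neg h, if_neg h4, add_sub_cancel_left]
      congr 1
      have h6 : conj ((r : ℂ) ^ 2 / conj (z - q)) = (r : ℂ) ^ 2 / (z - q) := by
        simp
      rw [h6]
      field_simp
      ring

/-- The reflection as a permutation of the sphere. -/
def reflPerm (q : ℂ) (r : ℝ) (hr : r ≠ 0) : Equiv.Perm (OnePoint ℂ) :=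
  (reflFun_involutive q r hr).toPerm

/-- The data of a nondegenerate circular domain of connectivity `g + 1`: the unit disk with `g`
mutually disjoint closed disks (of centre `q j` and radius `r j`) inside it removed. -/
structure CircularDomain (g : ℕ) where
  q : Fin g → ℂ
  r : Fin g → ℝ
  r_pos : ∀ j, 0 < r j
  inside : ∀ j, ‖q j‖ + r j < 1
  disjoint : ∀ i j, i ≠ j → r i + r j < ‖q i - q j‖

namespace CircularDomain

variable {g : ℕ} (D : CircularDomain g)

/-- The circular domain `Ω`. -/
def Omega : Set ℂ := {z | ‖z‖ < 1 ∧ ∀ j, D.r j < ‖z - D.q j‖}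

/-- The reflection `φ₀` in the unit circle. -/
def phi0 : Equiv.Perm (OnePoint ℂ) := reflPerm 0 1 one_ne_zero

/-- The reflection `φ_j` in the `j`-th inner boundary circle. -/
def phi (j : Fin g) : Equiv.Perm (OnePoint ℂ) := reflPerm (D.q j) (D.r j) (D.r_pos j).ne'

/-- The generator `θ_j = φ_j ∘ φ₀`. -/
def theta (j : Fin g) : Equiv.Perm (OnePoint ℂ) := D.phi j * phi0

/-- The finite expression of `θ_j`. -/
def thetaFun (j : Fin g) (z : ℂ) : ℂ :=
  D.q j + (D.r j : ℂ) ^ 2 * z / (1 - conj (D.q j) * z)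

/-- Away from its pole, `θ_j` is given by its finite expression. -/
theorem theta_coe (j : Fin g) (z : ℂ) (hz : 1 - conj (D.q j) * z ≠ 0) :
    D.theta j (z : OnePoint ℂ) = (D.thetaFun j z : OnePoint ℂ) := by
  change reflFun (D.q j) (D.r j) (reflFun 0 1 (z : OnePoint ℂ)) = _
  by_cases h : z = 0
  · simp [reflFun, thetaFun, h]
  · have hc : conj z ≠ 0 := by simpa using h
    have h1 : (1 : ℂ) / conj z ≠ D.q j := by
      intro h2
      apply hz
      rw [← h2]
      simp [h]
    have h4 : (1 / z - conj (D.q j)) ≠ 0 := by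
      intro h5
      apply hz
      field_simp at h5
      linear_combination h5
    simp only [reflFun, OnePoint.elim_some, if_neg h]
    simp only [sub_zero, ofReal_one, one_pow, zero_add, if_neg h1, thetaFun]
    congr 2
    have h6 : conj (1 / conj z - D.q j) = 1 / z - conj (D.q j) := by simp
    rw [h6]
    have h7 : 1 / z - conj (D.q j) = (1 - conj (D.q j) * z) / z := by
      field_simp
    rw [h7, div_div_eq_mul_div]

/-- The Schottky group `Θ`: the group of Möbius transformations of the sphere generated by
`θ_1, …, θ_g`. -/
def Theta : Subgroup (Equiv.Perm (OnePoint ℂ)) := Subgroup.closure (Set.range D.theta)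

/-- The Schottky double `Ω* = Ω ∪ γ₀ ∪ φ₀(Ω)`, a region of the sphere. -/
def double : Set (OnePoint ℂ) :=
  (fun z : ℂ => (z : OnePoint ℂ)) '' D.Omega ∪
    (fun z : ℂ => (z : OnePoint ℂ)) '' Metric.sphere 0 1 ∪
    phi0 '' ((fun z : ℂ => (z : OnePoint ℂ)) '' D.Omega)

/-- The finite points of the region of discontinuity `⋃_{θ ∈ Θ} θ(closure Ω*)`. -/
def ordinary : Set ℂ :=
  {z | ∃ θ ∈ D.Theta, ∃ w ∈ closure D.double, θ w = (z : OnePoint ℂ)}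

/-- `v_1, …, v_g` are the integrals of the first kind, and `τ` is their matrix of `b`-periods.
The functions `v_j` are many-valued, defined up to the integers; `v j z` is any one of the values,
and the single-valued functions are `exp (2 π i v_j)`, so that
`d v_j = (2 π i)⁻¹ d log (exp (2 π i v_j))`. -/
structure IsFirstKind (v : Fin g → ℂ → ℂ) (τ : Fin g → Fin g → ℂ) : Prop where
  analytic : ∀ j, AnalyticOnNhd ℂ (fun z => exp (2 * Real.pi * I * v j z)) D.ordinary
  /-- `∫_{γ_i} d v_j = δ_{ij}` -/
  a_period : ∀ i j,
    (∮ z in C(D.q i, D.r i),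
      (2 * Real.pi * I)⁻¹ * logDeriv (fun z => exp (2 * Real.pi * I * v j z)) z) =
        if i = j then 1 else 0
  /-- The periods `τ_{ij}` are purely imaginary -/
  tau_imag : ∀ i j, (τ i j).re = 0
  /-- `v_j (θ_i z) - v_j z = τ_{ij}` (modulo the integers): the integral of `d v_j` over a path
  from `z` to `θ_i z` -/
  b_period : ∀ i j, ∀ z ∈ D.ordinary, ∀ w : ℂ, D.theta i (z : OnePoint ℂ) = (w : OnePoint ℂ) →
    exp (2 * Real.pi * I * (v j w - v j z)) = exp (2 * Real.pi * I * τ i j)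

/-- `ω` is the Schottky–Klein prime function of the domain. The first variable runs through
the region of discontinuity, the second one through the Schottky double. -/
structure IsPrimeFunction (v : Fin g → ℂ → ℂ) (τ : Fin g → Fin g → ℂ) (ω : ℂ → ℂ → ℂ) :
    Prop where
  analytic : ∀ y : ℂ, (y : OnePoint ℂ) ∈ D.double →
    AnalyticOnNhd ℂ (fun z => ω z y) D.ordinary
  /-- a simple zero at every point `θ y` -/
  zero : ∀ y : ℂ, (y : OnePoint ℂ) ∈ D.double → ∀ z ∈ D.ordinary,
    (∃ θ ∈ D.Theta, θ (y : OnePoint ℂ) = (z : OnePoint ℂ)) →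
      analyticOrderAt (fun z => ω z y) z = 1
  /-- no other zeros -/
  ne_zero : ∀ y : ℂ, (y : OnePoint ℂ) ∈ D.double → ∀ z ∈ D.ordinary,
    (¬ ∃ θ ∈ D.Theta, θ (y : OnePoint ℂ) = (z : OnePoint ℂ)) → ω z y ≠ 0
  normalized : ∀ y : ℂ, (y : OnePoint ℂ) ∈ D.double →
    Tendsto (fun z => ω z y / (z - y)) (𝓝[≠] y) (𝓝 1)
  /-- `ω (θ_j z, y) = exp (2 π i (v_j y - v_j z) - π i τ_{jj}) √(dθ_j/dz) ω (z, y)`, where `s` is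
  a branch of the square root off the pole of `θ_j` -/
  shift : ∀ j, ∃ s : ℂ → ℂ,
    ContinuousOn s {z | 1 - conj (D.q j) * z ≠ 0} ∧
    (∀ z, 1 - conj (D.q j) * z ≠ 0 → s z ^ 2 = deriv (D.thetaFun j) z) ∧
    ∀ y : ℂ, (y : OnePoint ℂ) ∈ D.double → ∀ z ∈ D.ordinary, 1 - conj (D.q j) * z ≠ 0 →
      ω (D.thetaFun j z) y =
        exp (2 * Real.pi * I * (v j y - v j z) - Real.pi * I * τ j j) * s z * ω z y

/-- `Θ'` is a maximal subset of `Θ` that does not contain the identity and does not contain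
`θ⁻¹` whenever it contains `θ`. -/
def IsHalf (H : Set D.Theta) : Prop :=
  Maximal (fun S : Set D.Theta => (1 : D.Theta) ∉ S ∧ ∀ θ ∈ S, θ⁻¹ ∉ S) H

/-- `(a - w) / (b - w)` for `w` on the sphere, with the value `1` at `w = ∞`. -/
def diffRatio (a b : ℂ) : OnePoint ℂ → ℂ := fun x =>
  x.elim 1 fun w => (a - w) / (b - w)

/-- The factor `(z - θ y) (y - θ z) / ((z - θ z) (y - θ y))`. -/
def primeFactor (θ : Equiv.Perm (OnePoint ℂ)) (z y : ℂ) : ℂ :=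
  diffRatio z y (θ (y : OnePoint ℂ)) * diffRatio y z (θ (z : OnePoint ℂ))

/-- The infinite product form
`ω (z, y) = (z - y) ∏_{θ ∈ Θ'} (z - θ y) (y - θ z) / ((z - θ z) (y - θ y))`
at all finite points of the Schottky double (including the convergence of the product). -/
def HasProductForm (H : Set D.Theta) (ω : ℂ → ℂ → ℂ) : Prop :=
  ∀ z y : ℂ, (z : OnePoint ℂ) ∈ D.double → (y : OnePoint ℂ) ∈ D.double →
    ∃ P : ℂ, HasProd (fun θ : H => primeFactor (θ : D.Theta).1 z y) P ∧ ω z y = (z - y) * P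

end CircularDomain

/-- `η(z, p) = ω(z, p) / (|p| ω(z, 1 / conj p))`. -/
def slitMap (ω : ℂ → ℂ → ℂ) (z p : ℂ) : ℂ := ω z p / ((‖p‖ : ℂ) * ω z (conj p)⁻¹)

/-- The Blaschke factor `m(w, p) = (w - p) / (1 - conj p * w)` for `w` on the sphere; its value
at `w = ∞` is `-1 / conj p`. -/
def blaschke (w : OnePoint ℂ) (p : ℂ) : ℂ :=
  w.elim (-(conj p)⁻¹) fun x => (x - p) / (1 - conj p * x)

end

-- Write `[x,y]` for `x(cy+d) - (ay+b)`, the homogeneous form of `x - θ(y)`, and `s` for `1 / conj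
-- p`. Each factor on the right is the cross ratio `[p,z][s,1] / ([s,z][p,1])`. Passing to `θ⁻¹`
-- turns `[x,y]` into `-[y,x]`, so the factors of `θ` and `θ⁻¹` multiply to the quotient of the
-- prime factors at `(z,p)`, `(z,s)`, `(1,p)`, `(1,s)` (`blaschke_div_mul_inv`). The identity
-- supplies the prefactors `z - y`.
--
-- Pairing alone does not give unconditional convergence over `Θ`: the products over `Θ'` and its
-- inverses must converge separately. A Blaschke quotient minus `1` is a constant times (prime
-- factor at `(z,1)` minus `1`) times bounded terms (`blaschke_div_sub_one`). The product for
-- `ω(z,1)` has a nonzero value, hence converges absolutely (`HasProd.summable_norm_sub_one`), and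
-- comparison finishes.
--
-- Ping-pong on the holes and their reflections shows that nontrivial elements move the Schottky
-- double off itself. This gives the nonvanishing of the brackets and of `ω`, the bounds, and the
-- absence of involutions. The modulus at `1` comes from the symmetry under `φ₀`, which fixes `1`
-- and swaps `p` with `s`.

noncomputable section

-- Unconditional products, over a set and over a group.

/-- The Cauchy criterion for an unconditionally convergent product with a nonzero value. -/
theorem HasProd.vanishing_norm {ι : Type*} {F : ι → ℂ} {P : ℂ} (h : HasProd F P) (hP : P ≠ 0)
    {ε : ℝ} (hε : 0 < ε) :
    ∃ S : Finset ι, ∀ T : Finset ι, Disjoint T S → ‖∏ i ∈ T, F i - 1‖ < ε := by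
  classical
  wlog hε1 : ε ≤ 1 generalizing ε
  · obtain ⟨S, hS⟩ := this one_pos le_rfl
    exact ⟨S, fun T hT => (hS T hT).trans (not_le.1 hε1)⟩
  have hP' : 0 < ‖P‖ := norm_pos_iff.2 hP
  have h1 : ∀ᶠ S : Finset ι in atTop, ‖∏ i ∈ S, F i - P‖ < ε * ‖P‖ / 4 := by
    have h2 : Tendsto (fun S : Finset ι => ∏ i ∈ S, F i) atTop (𝓝 P) := h
    have h3 := (Metric.tendsto_nhds.1 h2) (ε * ‖P‖ / 4) (by positivity)
    simpa [dist_eq_norm] using h3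
  obtain ⟨S, hS⟩ := eventually_atTop.1 h1
  refine ⟨S, fun T hT => ?_⟩
  have hS1 := hS S le_rfl
  have hS2 := hS (T ∪ S) Finset.subset_union_right
  rw [Finset.prod_union hT] at hS2
  set a := ∏ i ∈ S, F i
  set b := ∏ i ∈ T, F i
  have h4 : ‖P‖ - ‖a‖ ≤ ‖a - P‖ := by
    rw [norm_sub_rev]; exact norm_sub_norm_le _ _
  have h5 : ‖P‖ / 2 < ‖a‖ := by nlinarith
  have h6 : ‖b - 1‖ * ‖a‖ < ε * ‖P‖ / 2 := by
    rw [← norm_mul]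
    calc ‖(b - 1) * a‖ = ‖(b * a - P) - (a - P)‖ := by ring_nf
      _ ≤ ‖b * a - P‖ + ‖a - P‖ := norm_sub_le _ _
      _ < ε * ‖P‖ / 2 := by linarith
  by_contra! h7
  nlinarith [norm_nonneg a]

/-- An unconditionally convergent product of complex numbers with a nonzero value converges
absolutely. -/
theorem HasProd.summable_norm_sub_one {ι : Type*} {F : ι → ℂ} {P : ℂ} (h : HasProd F P)
    (hP : P ≠ 0) : Summable fun i => ‖F i - 1‖ := by
  classical
  -- While all subproducts stay within `1/2` of `1`, their arguments lie in `(-π/2, π/2)`, so the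
  -- principal logarithm is additive.
  have key : ∀ T : Finset ι, (∀ T' ⊆ T, ‖∏ i ∈ T', F i - 1‖ ≤ 1 / 2) →
      ∑ i ∈ T, log (F i) = log (∏ i ∈ T, F i) := by
    intro T
    induction T using Finset.induction_on with
    | empty => simp
    | insert i T hi ih =>
      intro hT
      have hre : ∀ x : ℂ, ‖x - 1‖ ≤ 1 / 2 → 0 < x.re := by
        intro x hx
        have := (abs_re_le_norm (x - 1)).trans hx
        rw [abs_le] at this
        simp only [sub_re, one_re] at this
        linarith [this.1]
      have hne : ∀ x : ℂ, 0 < x.re → x ≠ 0 := by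
        rintro x hx rfl
        simp at hx
      have h1 : 0 < (F i).re := hre _ (by simpa using hT {i} (by simp))
      have h2 : 0 < (∏ j ∈ T, F j).re := hre _ (hT T (Finset.subset_insert _ _))
      rw [Finset.sum_insert hi, Finset.prod_insert hi,
        ih fun T' hT' => hT T' (hT'.trans (Finset.subset_insert _ _)),
        (log_mul_eq_add_log_iff (hne _ h1) (hne _ h2)).2]
      have h3 := abs_lt.1 (abs_arg_lt_pi_div_two_iff.2 (Or.inl h1))
      have h4 := abs_lt.1 (abs_arg_lt_pi_div_two_iff.2 (Or.inl h2))
      exact ⟨by linarith [h3.1, h4.1], by linarith [h3.2, h4.2]⟩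
  have hlog : Summable fun i => log (F i) := by
    rw [summable_iff_vanishing_norm]
    intro ε hε
    -- The bound `1/2` makes `key` applicable; `ε/2` absorbs the constant `3/2` in `|log (1 + w)| ≤
    -- (3/2)|w|`.
    obtain ⟨S, hS⟩ := h.vanishing_norm hP (ε := min (1 / 2) (ε / 2)) (by positivity)
    refine ⟨S, fun T hT => ?_⟩
    rw [key T fun T' hT' => ((hS T' (hT.mono_left hT')).trans_le (min_le_left _ _)).le]
    have h1 := hS T hT
    have h2 := norm_log_one_add_half_le_self (h1.trans_le (min_le_left _ _)).le
    rw [add_sub_cancel] at h2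
    have h3 := h1.trans_le (min_le_right _ _)
    linarith
  -- Outside this `S` no factor vanishes, since `0` is at distance `1` from `1`; there `exp (log (F
  -- i)) = F i`.
  obtain ⟨S, hS⟩ := h.vanishing_norm hP (ε := 1) one_pos
  have h1 : ∀ᶠ i in cofinite, ‖log (F i)‖ ≤ 1 := by
    have := hlog.tendsto_cofinite_zero.norm
    rw [norm_zero] at this
    exact (this.eventually (gt_mem_nhds one_pos)).mono fun _ => le_of_lt
  refine (hlog.norm.mul_left 2).of_norm_bounded_eventually ?_
  filter_upwards [h1, S.eventually_cofinite_notMem] with i hi hiS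
  have h2 : F i ≠ 0 := by
    intro h3
    have := hS {i} (by simpa using hiS)
    simp [h3] at this
  have h3 := norm_exp_sub_one_le hi
  rw [exp_log h2] at h3
  simpa using h3

/-- A product over a group is the product of the term at the identity and of the products over
`H` and `H⁻¹`, when `H` contains exactly one of any two nontrivial inverse elements. -/
theorem hasProd_of_half {G : Type*} [Group G] {H : Set G} (h1 : (1 : G) ∉ H)
    (hinv : ∀ θ ∈ H, θ⁻¹ ∉ H) (hcov : ∀ θ : G, θ ≠ 1 → θ ∈ H ∨ θ⁻¹ ∈ H) {f : G → ℂ} {a b : ℂ}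
    (ha : HasProd (fun θ : H => f θ) a) (hb : HasProd (fun θ : H => f (θ : G)⁻¹) b) :
    HasProd f (f 1 * (a * b)) := by
  have hb' : HasProd (f ∘ ((↑) : (H⁻¹ : Set G) → G)) b := by
    let e : H ≃ (H⁻¹ : Set G) := (Equiv.inv G).subtypeEquiv (by simp)
    rw [← e.hasProd_iff]
    exact hb
  have hab := HasProd.mul_disjoint (s := H) (t := H⁻¹)
    (Set.disjoint_left.2 fun θ h h' => hinv θ h h') ha hb'
  have h1' : HasProd (f ∘ ((↑) : ({1} : Set G) → G)) (f 1) := by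
    simpa using hasProd_unique (f ∘ ((↑) : ({1} : Set G) → G))
  refine h1'.mul_isCompl ?_ hab
  refine IsCompl.of_le ?_ ?_
  · rintro x ⟨hx, hx'⟩
    rcases hx with rfl
    rcases hx' with h | h
    · exact h1 h
    · exact h1 (by simpa using h)
  · intro x _
    by_cases hx : x = 1
    · exact Or.inl hx
    · exact Or.inr (hcov x hx)

/-- A maximal subset without the identity and without pairs of inverse elements, in a group
without involutions, contains one of any two nontrivial inverse elements. -/
theorem Maximal.mem_or_inv_mem {G : Type*} [Group G] {H : Set G}
    (hH : Maximal (fun S : Set G => (1 : G) ∉ S ∧ ∀ θ ∈ S, θ⁻¹ ∉ S) H)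
    (htors : ∀ θ : G, θ ≠ 1 → θ * θ ≠ 1) {θ : G} (hθ : θ ≠ 1) : θ ∈ H ∨ θ⁻¹ ∈ H := by
  by_contra! h
  refine h.1 (hH.mem_of_prop_insert ⟨?_, ?_⟩)
  · rintro (h1 | h1)
    · exact hθ h1.symm
    · exact hH.prop.1 h1
  · rintro x (rfl | hx) (h2 | h2)
    · exact htors x hθ (by nth_rewrite 1 [← h2]; simp)
    · exact h.2 h2
    · exact h.2 (by rwa [← h2, inv_inv])
    · exact hH.prop.2 x hx h2

-- Möbius maps in homogeneous coordinates and cross-ratio identities.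

/-- The point of the sphere with homogeneous coordinates `[n : m]`. -/
def homPoint (n m : ℂ) : OnePoint ℂ := if m = 0 then OnePoint.infty else ((n / m : ℂ) : OnePoint ℂ)

theorem homPoint_one (z : ℂ) : homPoint z 1 = (z : OnePoint ℂ) := by simp [homPoint]

theorem homPoint_mul {c : ℂ} (hc : c ≠ 0) (n m : ℂ) : homPoint (c * n) (c * m) = homPoint n m := by
  by_cases hm : m = 0
  · simp [homPoint, hm]
  · simp [homPoint, hm, hc, mul_div_mul_left]

theorem homPoint_eq_coe_iff {n m : ℂ} (h : n ≠ 0 ∨ m ≠ 0) (y : ℂ) :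
    homPoint n m = (y : OnePoint ℂ) ↔ y * m - n = 0 := by
  by_cases hm : m = 0
  · have hn : n ≠ 0 := by simpa [hm] using h
    simp [homPoint, hm, hn]
  · simp only [homPoint, hm, if_false, OnePoint.coe_eq_coe, div_eq_iff hm, sub_eq_zero]
    exact eq_comm

/-- At `m = 0` the right side is `(-n)/(-n) = 1`, the convention at `∞`; the point at infinity then
needs no separate treatment. -/
theorem diffRatio_homPoint {n m : ℂ} (h : n ≠ 0 ∨ m ≠ 0) (a b : ℂ) :
    CircularDomain.diffRatio a b (homPoint n m) = (a * m - n) / (b * m - n) := by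
  by_cases hm : m = 0
  · have hn : n ≠ 0 := by simpa [hm] using h
    simp [homPoint, hm, CircularDomain.diffRatio, hn]
  · simp only [homPoint, hm, if_false, CircularDomain.diffRatio, OnePoint.elim_some]
    rw [← mul_div_mul_right (a - n / m) (b - n / m) hm]
    simp [sub_mul, hm]

theorem blaschke_homPoint {n m : ℂ} (h : n ≠ 0 ∨ m ≠ 0) (p : ℂ) :
    blaschke (homPoint n m) p = (n - p * m) / (m - conj p * n) := by
  by_cases hm : m = 0
  · have hn : n ≠ 0 := by simpa [hm] using h
    simp only [homPoint, hm, if_true, blaschke, OnePoint.elim_infty]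
    by_cases hp : p = 0
    · simp [hp]
    · have : conj p ≠ 0 := by simpa using hp
      simp
      field_simp
  · simp only [homPoint, hm, if_false, blaschke, OnePoint.elim_some]
    rw [← mul_div_mul_right (n / m - p) (1 - conj p * (n / m)) hm]
    have h1 : (n / m - p) * m = n - p * m := by field_simp
    have h2 : (1 - conj p * (n / m)) * m = m - conj p * n := by field_simp
    rw [h1, h2]

/-- `θ` is the Möbius transformation with the invertible matrix `(a, b; c, d)`. -/
structure IsMobius (θ : Equiv.Perm (OnePoint ℂ)) (a b c d : ℂ) : Prop where
  det : a * d - b * c ≠ 0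
  map : ∀ n m : ℂ, n ≠ 0 ∨ m ≠ 0 → θ (homPoint n m) = homPoint (a * n + b * m) (c * n + d * m)

theorem matrix_apply_ne_zero {a b c d : ℂ} (hdet : a * d - b * c ≠ 0) {n m : ℂ}
    (h : n ≠ 0 ∨ m ≠ 0) : a * n + b * m ≠ 0 ∨ c * n + d * m ≠ 0 := by
  by_contra! h'
  have h1 : (a * d - b * c) * n = 0 := by linear_combination d * h'.1 - b * h'.2
  have h2 : (a * d - b * c) * m = 0 := by linear_combination a * h'.2 - c * h'.1
  simp [hdet] at h1 h2
  simp [h1, h2] at h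

namespace IsMobius

variable {θ η : Equiv.Perm (OnePoint ℂ)} {a b c d a' b' c' d' : ℂ}

theorem one : IsMobius 1 1 0 0 1 := ⟨by simp, by simp⟩

theorem mul (h : IsMobius θ a b c d) (h' : IsMobius η a' b' c' d') :
    IsMobius (θ * η) (a * a' + b * c') (a * b' + b * d') (c * a' + d * c') (c * b' + d * d') := by
  refine ⟨?_, fun n m hnm => ?_⟩
  · have := mul_ne_zero h.det h'.det
    contrapose! this
    linear_combination this
  · rw [Equiv.Perm.mul_apply, h'.map n m hnm, h.map _ _ (matrix_apply_ne_zero h'.det hnm)]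
    congr 1 <;> ring

theorem inv (h : IsMobius θ a b c d) : IsMobius θ⁻¹ d (-b) (-c) a := by
  refine ⟨?_, fun n m hnm => ?_⟩
  · have := h.det
    contrapose! this
    linear_combination this
  · have hdet : d * a - -b * -c ≠ 0 := by
      have := h.det
      contrapose! this
      linear_combination this
    rw [Equiv.Perm.inv_eq_iff_eq, h.map _ _ (matrix_apply_ne_zero hdet hnm), eq_comm,
      ← homPoint_mul h.det n m]
    congr 1 <;> ring

theorem apply_coe (h : IsMobius θ a b c d) (z : ℂ) :
    θ (z : OnePoint ℂ) = homPoint (a * z + b) (c * z + d) := by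
  simpa [homPoint_one] using h.map z 1 (by simp)

theorem coe_ne_zero (h : IsMobius θ a b c d) (z : ℂ) : a * z + b ≠ 0 ∨ c * z + d ≠ 0 := by
  simpa using matrix_apply_ne_zero h.det (n := z) (m := 1) (by simp)

theorem apply_eq_iff (h : IsMobius θ a b c d) (z y : ℂ) :
    θ (z : OnePoint ℂ) = (y : OnePoint ℂ) ↔ y * (c * z + d) - (a * z + b) = 0 := by
  rw [h.apply_coe, homPoint_eq_coe_iff (h.coe_ne_zero z)]

theorem diffRatio_apply (h : IsMobius θ a b c d) (x y z : ℂ) :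
    CircularDomain.diffRatio x y (θ (z : OnePoint ℂ)) =
      (x * (c * z + d) - (a * z + b)) / (y * (c * z + d) - (a * z + b)) := by
  rw [h.apply_coe, diffRatio_homPoint (h.coe_ne_zero z)]

theorem primeFactor_eq (h : IsMobius θ a b c d) (z y : ℂ) :
    CircularDomain.primeFactor θ z y =
      ((z * (c * y + d) - (a * y + b)) / (y * (c * y + d) - (a * y + b))) *
      ((y * (c * z + d) - (a * z + b)) / (z * (c * z + d) - (a * z + b))) := by
  rw [CircularDomain.primeFactor, h.diffRatio_apply, h.diffRatio_apply]

theorem blaschke_apply (h : IsMobius θ a b c d) (z p : ℂ) (hp : p ≠ 0) :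
    blaschke (θ (z : OnePoint ℂ)) p = (conj p)⁻¹ *
      ((p * (c * z + d) - (a * z + b)) / (-((conj p)⁻¹ * (c * z + d) - (a * z + b)))) := by
  have hp' : conj p ≠ 0 := by simpa using hp
  rw [h.apply_coe, blaschke_homPoint (h.coe_ne_zero z), ← div_eq_inv_mul, div_div,
    ← neg_div_neg_eq]
  congr 1
  · ring
  · field_simp

/-- The quotient of two Blaschke factors is a cross ratio. -/
theorem blaschke_div (h : IsMobius θ a b c d) (z p : ℂ) (hp : p ≠ 0) :
    blaschke (θ (z : OnePoint ℂ)) p / blaschke (θ ((1 : ℂ) : OnePoint ℂ)) p =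
      ((p * (c * z + d) - (a * z + b)) / ((conj p)⁻¹ * (c * z + d) - (a * z + b))) /
      ((p * (c * 1 + d) - (a * 1 + b)) / ((conj p)⁻¹ * (c * 1 + d) - (a * 1 + b))) := by
  have hp' : conj p ≠ 0 := by simpa using hp
  rw [h.blaschke_apply z p hp, h.blaschke_apply 1 p hp, mul_div_mul_left _ _ (inv_ne_zero hp'),
    div_neg, div_neg, neg_div_neg_eq]

/-- Inversion swaps the arguments of each bracket up to sign; the factor is symmetric under that
swap. It thus depends only on the pair `{θ, θ⁻¹}`. -/
theorem primeFactor_inv (h : IsMobius θ a b c d) (z y : ℂ) :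
    CircularDomain.primeFactor θ⁻¹ z y = CircularDomain.primeFactor θ z y := by
  rw [h.primeFactor_eq, h.inv.primeFactor_eq, div_mul_div_comm, div_mul_div_comm]
  congr 1 <;> ring

/-- The factors of `θ` and `θ⁻¹` in the product of Blaschke quotients, in terms of the factors of
`θ` in the products for the prime function. -/
theorem blaschke_div_mul_inv (h : IsMobius θ a b c d) {z p : ℂ} (hp : p ≠ 0)
    (hz : θ (z : OnePoint ℂ) ≠ (z : OnePoint ℂ))
    (h1 : θ ((1 : ℂ) : OnePoint ℂ) ≠ ((1 : ℂ) : OnePoint ℂ))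
    (hpp : θ (p : OnePoint ℂ) ≠ (p : OnePoint ℂ))
    (hss : θ (((conj p)⁻¹ : ℂ) : OnePoint ℂ) ≠ (((conj p)⁻¹ : ℂ) : OnePoint ℂ)) :
    (blaschke (θ (z : OnePoint ℂ)) p / blaschke (θ ((1 : ℂ) : OnePoint ℂ)) p) *
      (blaschke (θ⁻¹ (z : OnePoint ℂ)) p / blaschke (θ⁻¹ ((1 : ℂ) : OnePoint ℂ)) p) =
    (CircularDomain.primeFactor θ z p / CircularDomain.primeFactor θ z (conj p)⁻¹) /
      (CircularDomain.primeFactor θ 1 p / CircularDomain.primeFactor θ 1 (conj p)⁻¹) := by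
  rw [h.blaschke_div z p hp, h.inv.blaschke_div z p hp, h.primeFactor_eq, h.primeFactor_eq,
    h.primeFactor_eq, h.primeFactor_eq]
  rw [Ne, h.apply_eq_iff] at hz h1 hpp hss
  generalize (conj p)⁻¹ = s at *
  have e (x y : ℂ) : x * (-c * y + a) - (d * y + -b) = -(y * (c * x + d) - (a * x + b)) := by ring
  simp only [e, neg_div_neg_eq]
  generalize (1 : ℂ) * (c * 1 + d) - (a * 1 + b) = B11 at *
  generalize z * (c * z + d) - (a * z + b) = Bzz at *
  generalize p * (c * p + d) - (a * p + b) = Bpp at *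
  generalize s * (c * s + d) - (a * s + b) = Bss at *
  simp only [div_eq_mul_inv, mul_inv, inv_inv]
  have k1 := mul_inv_cancel₀ hz
  have k2 := mul_inv_cancel₀ h1
  have k3 := mul_inv_cancel₀ hpp
  have k4 := mul_inv_cancel₀ hss
  generalize Bzz⁻¹ = Czz at *
  generalize B11⁻¹ = C11 at *
  generalize Bpp⁻¹ = Cpp at *
  generalize Bss⁻¹ = Css at *
  generalize (p * (c * z + d) - (a * z + b)) = x1
  generalize (s * (c * z + d) - (a * z + b))⁻¹ = x2
  generalize (p * (c * 1 + d) - (a * 1 + b))⁻¹ = x3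
  generalize (s * (c * 1 + d) - (a * 1 + b)) = x4
  generalize (z * (c * p + d) - (a * p + b)) = x5
  generalize (z * (c * s + d) - (a * s + b))⁻¹ = x6
  generalize (1 * (c * p + d) - (a * p + b))⁻¹ = x7
  generalize (1 * (c * s + d) - (a * s + b)) = x8
  -- Only the diagonal brackets, at fixed-point positions, have to cancel. The mixed ones occur
  -- identically on both sides, so they may even be zero.
  have : x1 * x2 * (x3 * x4) * (x5 * x6 * (x7 * x8)) =
    (x1 * x2 * (x3 * x4) * (x5 * x6 * (x7 * x8))) *
      ((Bzz * Czz) * (B11 * C11) * (Bpp * Cpp) * (Bss * Css)) := by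
    rw [k1, k2, k3, k4]; ring
  rw [this]; ring

/-- The deviation from `1` of a quotient of Blaschke factors is controlled by that of `primeFactor`. -/
theorem blaschke_div_sub_one (h : IsMobius θ a b c d) {z p : ℂ} (hp : p ≠ 0) (hz1 : z ≠ 1)
    (hz : θ (z : OnePoint ℂ) ≠ (z : OnePoint ℂ))
    (h1 : θ ((1 : ℂ) : OnePoint ℂ) ≠ ((1 : ℂ) : OnePoint ℂ))
    (hs : θ (z : OnePoint ℂ) ≠ (((conj p)⁻¹ : ℂ) : OnePoint ℂ))
    (hp1 : θ ((1 : ℂ) : OnePoint ℂ) ≠ (p : OnePoint ℂ)) :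
    blaschke (θ (z : OnePoint ℂ)) p / blaschke (θ ((1 : ℂ) : OnePoint ℂ)) p - 1 =
      (((conj p)⁻¹ - p) / (z - 1)) * (CircularDomain.primeFactor θ z 1 - 1) *
      (CircularDomain.diffRatio z (conj p)⁻¹ (θ (z : OnePoint ℂ)) *
        CircularDomain.diffRatio 1 p (θ ((1 : ℂ) : OnePoint ℂ))) := by
  rw [h.blaschke_div z p hp, h.primeFactor_eq, h.diffRatio_apply, h.diffRatio_apply]
  rw [Ne, h.apply_eq_iff] at hz h1 hs hp1
  generalize (conj p)⁻¹ = s at *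
  have hz1' := sub_ne_zero.2 hz1
  -- Both numerators are multiples of `(cz+d)(a+b) - (az+b)(c+d)`, with coefficients `s - p` and `z
  -- - 1`; the two `diffRatio` terms exchange the denominators.
  rw [div_div_div_eq, div_sub_one (mul_ne_zero hs hp1), div_mul_div_comm,
    div_sub_one (mul_ne_zero h1 hz), div_mul_div_comm, div_mul_div_comm, div_mul_div_comm,
    div_eq_div_iff (mul_ne_zero hs hp1)
      (mul_ne_zero (mul_ne_zero hz1' (mul_ne_zero h1 hz)) (mul_ne_zero hs hp1))]
  ring

/-- The matrix of `η` is that of `φ₀ θ φ₀`. Reflecting both points conjugates each bracket up to a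
monomial factor, and these monomials cancel in the cross ratio. -/
theorem primeFactor_conj (h : IsMobius θ a b c d) (h' : IsMobius η (conj d) (conj c) (conj b)
    (conj a)) {z y : ℂ} (hz : z ≠ 0) (hy : y ≠ 0) :
    CircularDomain.primeFactor η (conj z)⁻¹ (conj y)⁻¹ =
      conj (CircularDomain.primeFactor θ z y) := by
  have e {x w : ℂ} (hx : x ≠ 0) (hw : w ≠ 0) :
      (conj x)⁻¹ * (conj b * (conj w)⁻¹ + conj a) - (conj d * (conj w)⁻¹ + conj c) =
        -(conj x)⁻¹ * (conj w)⁻¹ * conj (x * (c * w + d) - (a * w + b)) := by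
    have hx' : conj x ≠ 0 := by simpa using hx
    have hw' : conj w ≠ 0 := by simpa using hw
    simp only [map_sub, map_mul, map_add]
    field_simp
    ring
  have hz' : (conj z)⁻¹ ≠ 0 := by simpa using hz
  have hy' : (conj y)⁻¹ ≠ 0 := by simpa using hy
  rw [h.primeFactor_eq, h'.primeFactor_eq, e hz hy, e hy hy, e hy hz, e hz hz,
    mul_div_mul_comm, mul_div_mul_comm (-(conj y)⁻¹ * (conj z)⁻¹), map_mul, map_div₀, map_div₀]
  generalize conj (z * (c * y + d) - (a * y + b)) = B1
  generalize conj (y * (c * z + d) - (a * z + b)) = B2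
  generalize conj (y * (c * y + d) - (a * y + b)) = B3
  generalize conj (z * (c * z + d) - (a * z + b)) = B4
  generalize (conj z)⁻¹ = s at *
  generalize (conj y)⁻¹ = t at *
  have h1 : -s * t / (-t * t) = s / t := by field_simp
  have h2 : -t * s / (-s * s) = t / s := by field_simp
  rw [h1, h2]
  have h3 : s / t * (t / s) = 1 := by field_simp
  linear_combination B1 / B3 * (B2 / B4) * h3

end IsMobius

-- The Schottky group and its symmetry under `φ₀`.

theorem phi0_homPoint {n m : ℂ} (h : n ≠ 0 ∨ m ≠ 0) :
    CircularDomain.phi0 (homPoint n m) = homPoint (conj m) (conj n) := by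
  change reflFun 0 1 _ = _
  by_cases hm : m = 0
  · simp [homPoint, reflFun, hm, show n ≠ 0 by simpa [hm] using h]
  · by_cases hn : n = 0
    · simp [homPoint, reflFun, hm, hn]
    · simp [homPoint, reflFun, hm, hn]

theorem phi_homPoint {g : ℕ} (D : CircularDomain g) (j : Fin g) {n m : ℂ} (h : n ≠ 0 ∨ m ≠ 0) :
    D.phi j (homPoint n m) = homPoint (D.q j * conj (n - D.q j * m) + (D.r j : ℂ) ^ 2 * conj m)
      (conj (n - D.q j * m)) := by
  change reflFun _ _ _ = _
  by_cases hm : m = 0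
  · have hn : n ≠ 0 := by simpa [hm] using h
    simp [homPoint, reflFun, hm, hn]
  · by_cases hn : n - D.q j * m = 0
    · have h1 : n / m = D.q j := by rw [div_eq_iff hm]; linear_combination hn
      simp [homPoint, reflFun, hm, hn, h1]
    · have h1 : n / m ≠ D.q j := by
        rw [Ne, div_eq_iff hm]; contrapose! hn; linear_combination hn
      have h2 : conj (n - D.q j * m) ≠ 0 := (map_ne_zero _).2 hn
      have h3 : conj m ≠ 0 := by simpa using hm
      have h4 : n / m - D.q j = (n - D.q j * m) / m := by field_simp
      simp only [homPoint, hm, if_false, reflFun, OnePoint.elim_some, h1, h2, h4, map_div₀]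
      congr 1
      field_simp

namespace CircularDomain

variable {g : ℕ} (D : CircularDomain g)

theorem isMobius_theta (j : Fin g) :
    IsMobius (D.theta j) ((D.r j : ℂ) ^ 2 - D.q j * conj (D.q j)) (D.q j) (-conj (D.q j)) 1 := by
  have hr : (D.r j : ℂ) ≠ 0 := by exact_mod_cast (D.r_pos j).ne'
  refine ⟨?_, fun n m h => ?_⟩
  · rw [show ((D.r j : ℂ) ^ 2 - D.q j * conj (D.q j)) * 1 - D.q j * -conj (D.q j)
      = (D.r j : ℂ) ^ 2 by ring]
    exact pow_ne_zero _ hr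
  · rw [theta, Equiv.Perm.mul_apply, phi0_homPoint h, phi_homPoint D j (by simpa using h.symm)]
    simp only [map_sub, map_mul, conj_conj]
    congr 1 <;> ring

theorem exists_isMobius {θ : Equiv.Perm (OnePoint ℂ)} (hθ : θ ∈ D.Theta) :
    ∃ a b c d, IsMobius θ a b c d := by
  induction hθ using Subgroup.closure_induction with
  | mem x hx =>
    obtain ⟨j, rfl⟩ := hx
    exact ⟨_, _, _, _, D.isMobius_theta j⟩
  | one => exact ⟨_, _, _, _, IsMobius.one⟩
  | mul x y _ _ hx hy =>
    obtain ⟨_, _, _, _, hx⟩ := hx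
    obtain ⟨_, _, _, _, hy⟩ := hy
    exact ⟨_, _, _, _, hx.mul hy⟩
  | inv x _ hx =>
    obtain ⟨_, _, _, _, hx⟩ := hx
    exact ⟨_, _, _, _, hx.inv⟩

theorem phi0_mul_phi0 : phi0 * phi0 = 1 := by
  ext1 x
  exact reflFun_involutive 0 1 one_ne_zero x

theorem phi_mul_phi (j : Fin g) : D.phi j * D.phi j = 1 := by
  ext1 x
  exact reflFun_involutive _ _ (D.r_pos j).ne' x

theorem phi0_inv : phi0⁻¹ = phi0 := inv_eq_of_mul_eq_one_left phi0_mul_phi0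

theorem phi_inv (j : Fin g) : (D.phi j)⁻¹ = D.phi j := inv_eq_of_mul_eq_one_left (D.phi_mul_phi j)

/-- Conjugation by `φ₀` inverts every generator: `φ₀ (φ_j φ₀) φ₀ = φ₀ φ_j = θ_j⁻¹`. -/
theorem phi0_conj_mem {θ : Equiv.Perm (OnePoint ℂ)} (hθ : θ ∈ D.Theta) :
    phi0 * θ * phi0⁻¹ ∈ D.Theta := by
  have h : D.Theta ≤ D.Theta.comap (MulAut.conj phi0).toMonoidHom := by
    conv_lhs => rw [Theta]
    rw [Subgroup.closure_le]
    rintro _ ⟨j, rfl⟩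
    have : phi0 * D.theta j * phi0⁻¹ = (D.theta j)⁻¹ := by
      rw [theta, mul_inv_rev, D.phi_inv, mul_assoc, mul_assoc, mul_inv_cancel, mul_one, phi0_inv]
    simp only [Subgroup.coe_comap, Set.mem_preimage, MulEquiv.coe_toMonoidHom, MulAut.conj_apply,
      SetLike.mem_coe, this]
    exact D.Theta.inv_mem (Subgroup.subset_closure ⟨j, rfl⟩)
  exact h hθ

/-- Conjugation by `φ₀`, on the Schottky group. -/
def conjPhi0 : D.Theta ≃ D.Theta where
  toFun θ := ⟨phi0 * θ.1 * phi0⁻¹, D.phi0_conj_mem θ.2⟩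
  invFun θ := ⟨phi0 * θ.1 * phi0⁻¹, D.phi0_conj_mem θ.2⟩
  left_inv θ := by
    ext1
    simp only [phi0_inv, ← mul_assoc, phi0_mul_phi0, one_mul]
    rw [mul_assoc, phi0_mul_phi0, mul_one]
  right_inv θ := by
    ext1
    simp only [phi0_inv, ← mul_assoc, phi0_mul_phi0, one_mul]
    rw [mul_assoc, phi0_mul_phi0, mul_one]

theorem primeFactor_conjPhi0 (θ : D.Theta) {z y : ℂ} (hz : z ≠ 0) (hy : y ≠ 0) :
    primeFactor (D.conjPhi0 θ).1 (conj z)⁻¹ (conj y)⁻¹ = conj (primeFactor θ.1 z y) := by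
  obtain ⟨a, b, c, d, h⟩ := D.exists_isMobius θ.2
  refine h.primeFactor_conj ⟨?_, fun n m hnm => ?_⟩ hz hy
  · have := (map_ne_zero (starRingEnd ℂ)).2 h.det
    contrapose! this
    simp only [map_sub, map_mul]
    linear_combination this
  · have h1 : conj m ≠ 0 ∨ conj n ≠ 0 := by simpa using hnm.symm
    change (phi0 * θ.1 * phi0⁻¹) _ = _
    rw [phi0_inv, Equiv.Perm.mul_apply, Equiv.Perm.mul_apply, phi0_homPoint hnm, h.map _ _ h1,
      phi0_homPoint (matrix_apply_ne_zero h.det h1)]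
    simp only [map_add, map_mul, conj_conj]
    congr 1 <;> ring

end CircularDomain

-- Ping-pong: nontrivial elements move the Schottky double off itself.

namespace CircularDomain

variable {g : ℕ} (D : CircularDomain g)

theorem phi0_apply_apply (x : OnePoint ℂ) : phi0 (phi0 x) = x :=
  reflFun_involutive 0 1 one_ne_zero x

theorem phi0_coe {z : ℂ} (hz : z ≠ 0) : phi0 (z : OnePoint ℂ) = ((conj z)⁻¹ : ℂ) := by
  rw [← homPoint_one, phi0_homPoint (by simp)]
  simp [homPoint, hz]

/-- The closed disk removed at `q j`, on the sphere. -/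
def hole (j : Fin g) : Set (OnePoint ℂ) :=
  (fun z : ℂ => (z : OnePoint ℂ)) '' Metric.closedBall (D.q j) (D.r j)

/-- The disks bounding the Schottky double: the holes and their reflections. -/
def disk : Fin g × Bool → Set (OnePoint ℂ)
  | (j, true) => D.hole j
  | (j, false) => phi0 '' D.hole j

/-- The generators of the Schottky group and their inverses. -/
def letter (s : Fin g × Bool) : Equiv.Perm (OnePoint ℂ) :=
  cond s.2 (D.theta s.1) (D.theta s.1)⁻¹

/-- The open unit disk on the sphere. -/
def unitDisk : Set (OnePoint ℂ) := (fun z : ℂ => (z : OnePoint ℂ)) '' Metric.ball 0 1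

theorem phi0_notMem_unitDisk {x : OnePoint ℂ} (hx : x ∈ unitDisk) : phi0 x ∉ unitDisk := by
  obtain ⟨z, hz, rfl⟩ := hx
  rw [mem_ball_zero_iff] at hz
  rintro ⟨w, hw, h⟩
  rw [mem_ball_zero_iff] at hw
  by_cases h0 : z = 0
  · subst h0
    dsimp only at h
    rw [← homPoint_one 0, phi0_homPoint (by simp)] at h
    simp [homPoint] at h
  · dsimp only at h
    rw [phi0_coe h0, OnePoint.coe_eq_coe] at h
    rw [h, norm_inv, RCLike.norm_conj] at hw
    have := one_lt_inv₀ (norm_pos_iff.2 h0) |>.2 hz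
    linarith

theorem hole_subset_unitDisk (j : Fin g) : D.hole j ⊆ unitDisk := by
  rintro _ ⟨z, hz, rfl⟩
  refine ⟨z, ?_, rfl⟩
  rw [mem_closedBall_iff_norm] at hz
  rw [mem_ball_zero_iff]
  have h1 := D.inside j
  have h2 := norm_add_le (z - D.q j) (D.q j)
  rw [sub_add_cancel] at h2
  linarith

theorem disjoint_hole {i j : Fin g} (h : i ≠ j) : Disjoint (D.hole i) (D.hole j) := by
  rw [Set.disjoint_left]
  rintro _ ⟨z, hz, rfl⟩ ⟨w, hw, h'⟩
  dsimp only at h'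
  rw [OnePoint.coe_eq_coe] at h'
  subst h'
  rw [mem_closedBall_iff_norm] at hz hw
  have h1 := D.disjoint i j h
  have h2 := norm_sub_le (w - D.q j) (w - D.q i)
  rw [sub_sub_sub_cancel_left] at h2
  linarith

theorem disjoint_hole_phi0_hole (i j : Fin g) : Disjoint (D.hole i) (phi0 '' D.hole j) := by
  rw [Set.disjoint_right]
  rintro _ ⟨x, hx, rfl⟩ h
  exact phi0_notMem_unitDisk (D.hole_subset_unitDisk j hx) (D.hole_subset_unitDisk i h)

theorem disjoint_disk {s t : Fin g × Bool} (h : s ≠ t) : Disjoint (D.disk s) (D.disk t) := by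
  rcases s with ⟨i, _ | _⟩ <;> rcases t with ⟨j, _ | _⟩
  · have hij : i ≠ j := fun h' => h (by rw [h'])
    exact (Set.disjoint_image_iff phi0.injective).2 (D.disjoint_hole hij)
  · exact (D.disjoint_hole_phi0_hole j i).symm
  · exact D.disjoint_hole_phi0_hole i j
  · have hij : i ≠ j := fun h' => h (by rw [h'])
    exact D.disjoint_hole hij

theorem phi_mem_hole {j : Fin g} {x : OnePoint ℂ} (hx : x ∉ D.hole j) : D.phi j x ∈ D.hole j := by
  have hr := D.r_pos j
  change reflFun _ _ _ ∈ _
  induction x using OnePoint.rec with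
  | infty => exact ⟨D.q j, by simp [hr.le], rfl⟩
  | coe z =>
    have hz : D.r j < ‖z - D.q j‖ := by
      by_contra! h
      exact hx ⟨z, by rwa [mem_closedBall_iff_norm], rfl⟩
    have hzq : z ≠ D.q j := by
      rintro rfl
      simp only [sub_self, norm_zero] at hz
      linarith
    simp only [reflFun, OnePoint.elim_some, if_neg hzq]
    refine ⟨_, ?_, rfl⟩
    rw [mem_closedBall_iff_norm, add_sub_cancel_left, norm_div, RCLike.norm_conj, norm_pow,
      norm_real, Real.norm_eq_abs, abs_of_pos hr, div_le_iff₀ (hr.trans hz)]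
    nlinarith

/-- The ping-pong move. For `θ_j = φ_j φ₀`, the reflection `φ₀` carries the exterior of the
reflected hole to the exterior of the hole, which `φ_j` folds into the hole; for the inverse the
roles are exchanged. -/
theorem letter_mem_disk {s : Fin g × Bool} {x : OnePoint ℂ} (hx : x ∉ D.disk (s.1, !s.2)) :
    D.letter s x ∈ D.disk s := by
  rcases s with ⟨j, _ | _⟩
  · change (D.theta j)⁻¹ x ∈ phi0 '' D.hole j
    rw [theta, mul_inv_rev, phi0_inv, D.phi_inv]
    exact ⟨_, D.phi_mem_hole hx, rfl⟩
  · change D.phi j (phi0 x) ∈ D.hole j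
    exact D.phi_mem_hole fun h => hx ⟨_, h, phi0_apply_apply x⟩

theorem coe_Omega_disjoint_hole (j : Fin g) :
    Disjoint ((fun z : ℂ => (z : OnePoint ℂ)) '' D.Omega) (D.hole j) := by
  rw [Set.disjoint_left]
  rintro _ ⟨z, hz, rfl⟩ ⟨w, hw, h'⟩
  dsimp only at h'
  rw [OnePoint.coe_eq_coe] at h'
  subst h'
  rw [mem_closedBall_iff_norm] at hw
  linarith [hz.2 j]

theorem coe_Omega_subset_unitDisk : (fun z : ℂ => (z : OnePoint ℂ)) '' D.Omega ⊆ unitDisk := by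
  rintro _ ⟨z, hz, rfl⟩
  exact ⟨z, by simpa using hz.1, rfl⟩

theorem coe_sphere_notMem_unitDisk {z : ℂ} (hz : z ∈ Metric.sphere (0 : ℂ) 1) :
    (z : OnePoint ℂ) ∉ unitDisk := by
  rintro ⟨w, hw, h⟩
  dsimp only at h
  rw [OnePoint.coe_eq_coe] at h
  subst h
  simp at hw hz
  linarith

theorem phi0_coe_sphere {z : ℂ} (hz : z ∈ Metric.sphere (0 : ℂ) 1) :
    phi0 (z : OnePoint ℂ) = (z : OnePoint ℂ) := by
  have hz' : ‖z‖ = 1 := by simpa using hz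
  have h0 : z ≠ 0 := norm_ne_zero_iff.1 (by simp [hz'])
  rw [phi0_coe h0, OnePoint.coe_eq_coe, ← inv_eq_conj hz', inv_inv]

theorem phi0_mem_double {x : OnePoint ℂ} (hx : x ∈ D.double) : phi0 x ∈ D.double := by
  rcases hx with (hx | ⟨z, hz, rfl⟩) | ⟨y, hy, rfl⟩
  · exact Or.inr ⟨x, hx, rfl⟩
  · rw [phi0_coe_sphere hz]
    exact Or.inl (Or.inr ⟨z, hz, rfl⟩)
  · rw [phi0_apply_apply]
    exact Or.inl (Or.inl hy)

theorem disjoint_double_hole (j : Fin g) : Disjoint D.double (D.hole j) := by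
  rw [Set.disjoint_left]
  rintro x ((hx | ⟨z, hz, rfl⟩) | ⟨y, hy, rfl⟩) h
  · exact Set.disjoint_left.1 (D.coe_Omega_disjoint_hole j) hx h
  · exact coe_sphere_notMem_unitDisk hz (D.hole_subset_unitDisk j h)
  · exact phi0_notMem_unitDisk (D.coe_Omega_subset_unitDisk hy) (D.hole_subset_unitDisk j h)

theorem disjoint_double_disk (s : Fin g × Bool) : Disjoint D.double (D.disk s) := by
  rcases s with ⟨j, _ | _⟩
  · rw [Set.disjoint_left]
    rintro _ hx ⟨y, hy, rfl⟩
    have := D.phi0_mem_double hx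
    rw [phi0_apply_apply] at this
    exact Set.disjoint_left.1 (D.disjoint_double_hole j) this hy
  · exact D.disjoint_double_hole j

/-- A reduced word maps the Schottky double into the disk belonging to its first letter. -/
theorem word_mem_disk {s : Fin g × Bool} {L : List (Fin g × Bool)}
    (hL : FreeGroup.IsReduced (s :: L)) {x : OnePoint ℂ} (hx : x ∈ D.double) :
    ((s :: L).map D.letter).prod x ∈ D.disk s := by
  induction L generalizing s with
  | nil =>
    simpa using D.letter_mem_disk (Set.disjoint_left.1 (D.disjoint_double_disk _) hx)
  | cons t L ih =>
    rw [FreeGroup.isReduced_cons_cons] at hL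
    rw [List.map_cons, List.prod_cons, Equiv.Perm.mul_apply]
    refine D.letter_mem_disk (Set.disjoint_left.1 (D.disjoint_disk ?_) (ih hL.2))
    rintro rfl
    simpa using hL.1 rfl

theorem exists_freeGroup {θ : Equiv.Perm (OnePoint ℂ)} (hθ : θ ∈ D.Theta) :
    ∃ w : FreeGroup (Fin g), FreeGroup.lift D.theta w = θ := by
  have h : D.Theta ≤ (FreeGroup.lift D.theta).range := by
    rw [Theta, Subgroup.closure_le]
    rintro _ ⟨j, rfl⟩
    exact ⟨FreeGroup.of j, by simp⟩
  exact h hθ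

theorem lift_notMem_double {w : FreeGroup (Fin g)} (hw : w ≠ 1) {x : OnePoint ℂ}
    (hx : x ∈ D.double) : FreeGroup.lift D.theta w x ∉ D.double := by
  have h1 : FreeGroup.lift D.theta w = (w.toWord.map D.letter).prod := by
    conv_lhs => rw [← FreeGroup.mk_toWord (x := w), FreeGroup.lift_mk]
    rfl
  have h2 : FreeGroup.IsReduced w.toWord := FreeGroup.isReduced_toWord
  rw [h1]
  cases h3 : w.toWord with
  | nil => exact absurd (FreeGroup.toWord_eq_nil_iff.1 h3) hw
  | cons s L =>
    rw [h3] at h2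
    exact Set.disjoint_right.1 (D.disjoint_double_disk s) (D.word_mem_disk h2 hx)

theorem notMem_double {θ : D.Theta} (hθ : θ ≠ 1) {x : OnePoint ℂ} (hx : x ∈ D.double) :
    θ.1 x ∉ D.double := by
  obtain ⟨w, hw⟩ := D.exists_freeGroup θ.2
  rw [← hw]
  refine D.lift_notMem_double ?_ hx
  rintro rfl
  exact hθ (Subtype.ext (by simpa using hw.symm))

theorem one_mem_double : ((1 : ℂ) : OnePoint ℂ) ∈ D.double := Or.inl (Or.inr ⟨1, by simp, rfl⟩)

/-- A lift `w` of `θ` to the free group has `w² ≠ 1`, as free groups are torsion-free; by ping-pong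
`θ²` moves the point `1` off the double. -/
theorem mul_self_ne_one {θ : D.Theta} (hθ : θ ≠ 1) : θ * θ ≠ 1 := by
  obtain ⟨w, hw⟩ := D.exists_freeGroup θ.2
  have hw1 : w ≠ 1 := by
    rintro rfl
    exact hθ (Subtype.ext (by simpa using hw.symm))
  have hw2 : w * w ≠ 1 := by
    rw [← sq]
    exact fun h => hw1 ((pow_eq_one_iff_left two_ne_zero).1 h)
  intro h
  apply D.lift_notMem_double hw2 D.one_mem_double
  have h1 := congrArg Subtype.val h
  rw [map_mul, hw]
  simp only [Subgroup.coe_mul, Subgroup.coe_one] at h1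
  rw [h1]
  exact D.one_mem_double

theorem coe_mem_double {z : ℂ} (hz : z ∈ D.Omega) : (z : OnePoint ℂ) ∈ D.double :=
  Or.inl (Or.inl ⟨z, hz, rfl⟩)

theorem conj_inv_mem_double {z : ℂ} (hz : z ∈ D.Omega) (h0 : z ≠ 0) :
    (((conj z)⁻¹ : ℂ) : OnePoint ℂ) ∈ D.double := by
  rw [← phi0_coe h0]
  exact D.phi0_mem_double (D.coe_mem_double hz)

theorem mem_ordinary {z : ℂ} (hz : (z : OnePoint ℂ) ∈ D.double) : z ∈ D.ordinary :=
  ⟨1, D.Theta.one_mem, z, subset_closure hz, rfl⟩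

theorem isOpen_Omega : IsOpen D.Omega := by
  refine IsOpen.and (isOpen_lt (by fun_prop) (by fun_prop)) ?_
  simp only [Set.ofPred_forall]
  exact isOpen_iInter_of_finite fun j => isOpen_lt (by fun_prop) (by fun_prop)

theorem double_mem_nhds {p : ℂ} (hp : p ∈ D.Omega) :
    {w : ℂ | (w : OnePoint ℂ) ∈ D.double} ∈ 𝓝 p :=
  Filter.mem_of_superset (D.isOpen_Omega.mem_nhds hp) fun _ => D.coe_mem_double

theorem double_mem_nhds_conj_inv {p : ℂ} (hp : p ∈ D.Omega) (h0 : p ≠ 0) :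
    {w : ℂ | (w : OnePoint ℂ) ∈ D.double} ∈ 𝓝 (conj p)⁻¹ := by
  have h1 : (conj p)⁻¹ ≠ 0 := by simpa using h0
  have hc : ContinuousAt (fun w : ℂ => (conj w)⁻¹) (conj p)⁻¹ :=
    (continuous_conj.continuousAt).inv₀ (by simpa using h0)
  have h2 : D.Omega ∈ 𝓝 ((fun w : ℂ => (conj w)⁻¹) (conj p)⁻¹) := by
    simpa using D.isOpen_Omega.mem_nhds hp
  filter_upwards [hc h2, isOpen_ne.mem_nhds h1] with w hw hw0
  have := D.conj_inv_mem_double hw (by simpa using hw0)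
  simpa using this

/-- `diffRatio` is bounded off any neighbourhood of its pole. -/
theorem diffRatio_bounded {S : Set (OnePoint ℂ)} {b : ℂ} (hS : {w : ℂ | (w : OnePoint ℂ) ∈ S} ∈ 𝓝 b)
    (a : ℂ) : ∃ C, ∀ x ∉ S, ‖diffRatio a b x‖ ≤ C := by
  obtain ⟨ε, hε, hb⟩ := Metric.mem_nhds_iff.1 hS
  refine ⟨1 + ‖a - b‖ / ε, fun x hx => ?_⟩
  induction x using OnePoint.rec with
  | infty =>
    have : 0 ≤ ‖a - b‖ / ε := by positivity
    simpa [diffRatio] using this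
  | coe w =>
    have hw : ε ≤ ‖b - w‖ := by
      by_contra! h
      exact hx (hb (by rwa [Metric.mem_ball, dist_comm, dist_eq_norm]))
    have h0 : b - w ≠ 0 := norm_ne_zero_iff.1 (hε.trans_le hw).ne'
    have h1 : diffRatio a b (w : OnePoint ℂ) = 1 + (a - b) / (b - w) := by
      change (a - w) / (b - w) = _
      field_simp
      ring
    rw [h1]
    refine (norm_add_le _ _).trans ?_
    rw [norm_one, norm_div]
    gcongr

end CircularDomain

-- Nonvanishing, moduli and convergence of the products.

namespace CircularDomain

variable {g : ℕ} (D : CircularDomain g)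

theorem apply_ne_of_mem_double {θ : D.Theta} (hθ : θ ≠ 1) {z y : ℂ}
    (hz : (z : OnePoint ℂ) ∈ D.double) (hy : (y : OnePoint ℂ) ∈ D.double) :
    θ.1 (z : OnePoint ℂ) ≠ (y : OnePoint ℂ) :=
  fun h => D.notMem_double hθ hz (h ▸ hy)

theorem ne_one_of_mem {H : Set D.Theta} (hH : D.IsHalf H) (θ : H) : (θ : D.Theta) ≠ 1 :=
  fun h => hH.prop.1 (h ▸ θ.2)

/-- The zeros form the orbit of `y`, which meets the double only in `y`. This makes the values of
the infinite products nonzero. -/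
theorem IsPrimeFunction.apply_ne_zero {D : CircularDomain g} {v : Fin g → ℂ → ℂ}
    {τ : Fin g → Fin g → ℂ} {ω : ℂ → ℂ → ℂ} (hω : D.IsPrimeFunction v τ ω) {z y : ℂ}
    (hz : (z : OnePoint ℂ) ∈ D.double) (hy : (y : OnePoint ℂ) ∈ D.double) (hzy : z ≠ y) :
    ω z y ≠ 0 := by
  refine hω.ne_zero y hy z (D.mem_ordinary hz) ?_
  rintro ⟨θ, hθ, h⟩
  by_cases h1 : (⟨θ, hθ⟩ : D.Theta) = 1
  · obtain rfl : θ = 1 := congrArg Subtype.val h1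
    exact hzy (OnePoint.coe_injective h).symm
  · exact D.apply_ne_of_mem_double h1 hy hz h

theorem hasProd_half {H : Set D.Theta} (hH : D.IsHalf H) {f : D.Theta → ℂ} {a b : ℂ}
    (ha : HasProd (fun θ : H => f θ) a) (hb : HasProd (fun θ : H => f (θ : D.Theta)⁻¹) b) :
    HasProd f (f 1 * (a * b)) :=
  hasProd_of_half hH.prop.1 hH.prop.2
    (fun _ hθ => Maximal.mem_or_inv_mem hH (fun _ h => D.mul_self_ne_one h) hθ) ha hb

theorem primeFactor_inv (θ : D.Theta) (z y : ℂ) :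
    primeFactor (θ⁻¹).1 z y = primeFactor θ.1 z y := by
  obtain ⟨a, b, c, d, h⟩ := D.exists_isMobius θ.2
  exact h.primeFactor_inv z y

-- `Θ'` need not be stable under conjugation by `φ₀`, but `Θ` is; squaring the product moves it to
-- the whole group. The identity is set to `1` by hand because its prime factor has zero
-- denominators.
open Classical in
theorem hasProd_primeFactor {H : Set D.Theta} (hH : D.IsHalf H) {z y P : ℂ}
    (h : HasProd (fun θ : H => primeFactor (θ : D.Theta).1 z y) P) :
    HasProd (fun θ : D.Theta => if θ = 1 then 1 else primeFactor θ.1 z y) (P * P) := by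
  have := D.hasProd_half hH (f := fun θ => if θ = 1 then 1 else primeFactor θ.1 z y)
    (a := P) (b := P) (by simpa only [D.ne_one_of_mem hH, if_false] using h)
    (by simpa only [inv_eq_one, D.ne_one_of_mem hH, if_false, D.primeFactor_inv] using h)
  simpa using this

/-- The products for `ω (1, p)` and `ω (1, 1 / conj p)` have the same modulus. -/
theorem norm_prod_eq {H : Set D.Theta} (hH : D.IsHalf H) {p Q R : ℂ} (hp : p ≠ 0)
    (hQ : HasProd (fun θ : H => primeFactor (θ : D.Theta).1 1 p) Q)
    (hR : HasProd (fun θ : H => primeFactor (θ : D.Theta).1 1 (conj p)⁻¹) R) : ‖Q‖ = ‖R‖ := by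
  classical
  have h1 := (D.hasProd_primeFactor hH hQ).map (starRingEnd ℂ) continuous_conj
  -- Since `φ₀` fixes `1` and takes `p` to `1 / conj p`, this reindexing identifies `R²` with the
  -- conjugate of `Q²`.
  have h2 := D.conjPhi0.hasProd_iff.2 (D.hasProd_primeFactor hH hR)
  have h3 : ∀ θ : D.Theta, D.conjPhi0 θ = 1 ↔ θ = 1 := by
    intro θ
    rw [← Subtype.coe_inj, ← Subtype.coe_inj]
    exact conj_eq_one_iff
  have h4 : ((fun θ : D.Theta => if θ = 1 then 1 else primeFactor θ.1 1 (conj p)⁻¹) ∘ D.conjPhi0) =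
      (starRingEnd ℂ) ∘ fun θ : D.Theta => if θ = 1 then 1 else primeFactor θ.1 1 p := by
    ext1 θ
    simp only [Function.comp_apply, h3]
    split_ifs
    · simp
    · simpa using D.primeFactor_conjPhi0 θ one_ne_zero hp
  rw [h4] at h2
  have h5 := congrArg norm (h1.unique h2)
  rw [RCLike.norm_conj, norm_mul, norm_mul] at h5
  exact (mul_self_inj (norm_nonneg _) (norm_nonneg _)).1 h5

/-- Comparison with the product for `ω(z,1)`: the images of `z` and `1` avoid the double, a
neighbourhood of `1 / conj p` and of `p`, so both `diffRatio` terms are bounded uniformly. The map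
`e` will be the inclusion and then the inversion. -/
theorem summable_blaschke_div_sub_one {H : Set D.Theta} {z p P : ℂ} (hz : z ∈ D.Omega)
    (hp : p ∈ D.Omega) (hp0 : p ≠ 0)
    (h : HasProd (fun θ : H => primeFactor (θ : D.Theta).1 z 1) P) (hP : P ≠ 0)
    (e : H → D.Theta) (he : ∀ θ, e θ ≠ 1)
    (hF : ∀ θ : H, primeFactor (e θ).1 z 1 = primeFactor (θ : D.Theta).1 z 1) :
    Summable fun θ : H => ‖blaschke ((e θ).1 (z : OnePoint ℂ)) p /
      blaschke ((e θ).1 ((1 : ℂ) : OnePoint ℂ)) p - 1‖ := by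
  have hz1 : z ≠ 1 := by
    rintro rfl
    simpa using hz.1
  have hzd := D.coe_mem_double hz
  have hpd := D.coe_mem_double hp
  have hsd := D.conj_inv_mem_double hp hp0
  obtain ⟨C₁, hC₁⟩ := diffRatio_bounded (D.double_mem_nhds_conj_inv hp hp0) z
  obtain ⟨C₂, hC₂⟩ := diffRatio_bounded (D.double_mem_nhds hp) 1
  refine ((h.summable_norm_sub_one hP).mul_left
    (‖((conj p)⁻¹ - p) / (z - 1)‖ * (C₁ * C₂))).of_nonneg_of_le (fun _ => norm_nonneg _)
    fun θ => ?_
  obtain ⟨a, b, c, d, hM⟩ := D.exists_isMobius (e θ).2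
  rw [hM.blaschke_div_sub_one hp0 hz1 (D.apply_ne_of_mem_double (he θ) hzd hzd)
    (D.apply_ne_of_mem_double (he θ) D.one_mem_double D.one_mem_double)
    (D.apply_ne_of_mem_double (he θ) hzd hsd)
    (D.apply_ne_of_mem_double (he θ) D.one_mem_double hpd), hF, norm_mul, norm_mul, norm_mul,
    mul_right_comm]
  have b1 := hC₁ _ (D.notMem_double (he θ) hzd)
  have b2 := hC₂ _ (D.notMem_double (he θ) D.one_mem_double)
  have := (norm_nonneg _).trans b1
  gcongr

end CircularDomain

end

-- The theorem.

open CircularDomain in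
theorem proposition2p1 {g : ℕ} (D : CircularDomain g)
    (v : Fin g → ℂ → ℂ) (τ : Fin g → Fin g → ℂ) (hv : D.IsFirstKind v τ)
    (ω : ℂ → ℂ → ℂ) (hω : D.IsPrimeFunction v τ ω)
    (H : Set D.Theta) (hH : D.IsHalf H) (hprod : D.HasProductForm H ω)
    (p : ℂ) (hp : p ∈ D.Omega) (hp0 : p ≠ 0) :
    ‖slitMap ω 1 p‖ = 1 ∧
    ∀ z ∈ D.Omega,
      HasProd (fun θ : D.Theta =>
          blaschke (θ.1 (z : OnePoint ℂ)) p / blaschke (θ.1 ((1 : ℂ) : OnePoint ℂ)) p)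
        (slitMap ω z p / slitMap ω 1 p) := by
  have hpd := D.coe_mem_double hp
  have hsd := D.conj_inv_mem_double hp hp0
  have h1d := D.one_mem_double
  have hp' : conj p ≠ 0 := by simpa using hp0
  have hpn : (‖p‖ : ℂ) ≠ 0 := by simpa using hp0
  have hs1 : 1 < ‖(conj p)⁻¹‖ := by
    rw [norm_inv, RCLike.norm_conj]
    exact (one_lt_inv₀ (norm_pos_iff.2 hp0)).2 hp.1
  have h1p : (1 : ℂ) ≠ p := by
    rintro rfl
    simpa using hp.1
  have h1s : (1 : ℂ) ≠ (conj p)⁻¹ := by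
    intro h
    rw [← h] at hs1
    simp at hs1
  obtain ⟨Q₁, hQ₁, eQ₁⟩ := hprod 1 p h1d hpd
  obtain ⟨R₁, hR₁, eR₁⟩ := hprod 1 (conj p)⁻¹ h1d hsd
  have hQ₁0 : Q₁ ≠ 0 := right_ne_zero_of_mul (eQ₁ ▸ hω.apply_ne_zero h1d hpd h1p)
  have hR₁0 : R₁ ≠ 0 := right_ne_zero_of_mul (eR₁ ▸ hω.apply_ne_zero h1d hsd h1s)
  constructor
  · rw [slitMap, eQ₁, eR₁, norm_div, norm_mul, norm_mul, norm_mul, D.norm_prod_eq hH hp0 hQ₁ hR₁,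
      norm_real, norm_norm]
    have h2 : ‖p‖ * ‖1 - (conj p)⁻¹‖ = ‖1 - p‖ := by
      rw [← RCLike.norm_conj p, ← norm_mul, mul_sub, mul_inv_cancel₀ hp', mul_one, ← norm_neg,
        neg_sub, ← RCLike.norm_conj (1 - p), map_sub, map_one]
    rw [← mul_assoc, h2]
    exact div_self (mul_ne_zero (norm_ne_zero_iff.2 (sub_ne_zero.2 h1p))
      (norm_ne_zero_iff.2 hR₁0))
  · intro z hz
    have hzd := D.coe_mem_double hz
    have hz1 : z ≠ 1 := by
      rintro rfl
      simpa using hz.1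
    have hzs : z ≠ (conj p)⁻¹ := by
      rintro rfl
      exact lt_asymm hs1 hz.1
    obtain ⟨Q, hQ, eQ⟩ := hprod z p hzd hpd
    obtain ⟨R, hR, eR⟩ := hprod z (conj p)⁻¹ hzd hsd
    -- The product at `(z, 1)` serves only as the majorant for convergence; its value does not enter
    -- the formula.
    obtain ⟨P, hP, eP⟩ := hprod z 1 hzd h1d
    have hR0 : R ≠ 0 := right_ne_zero_of_mul (eR ▸ hω.apply_ne_zero hzd hsd hzs)
    have hP0 : P ≠ 0 := right_ne_zero_of_mul (eP ▸ hω.apply_ne_zero hzd h1d hz1)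
    set f : D.Theta → ℂ := fun θ =>
      blaschke (θ.1 (z : OnePoint ℂ)) p / blaschke (θ.1 ((1 : ℂ) : OnePoint ℂ)) p with hf
    have hmul : ∀ e : H → D.Theta, (∀ θ, e θ ≠ 1) →
        (∀ θ : H, primeFactor (e θ).1 z 1 = primeFactor (θ : D.Theta).1 z 1) →
        ∃ A, HasProd (fun θ => f (e θ)) A := by
      intro e he hF
      have := multipliable_one_add_of_summable
        (D.summable_blaschke_div_sub_one hz hp hp0 hP hP0 e he hF)
      simp only [add_sub_cancel] at this
      exact this
    obtain ⟨A, hA⟩ := hmul (fun θ => θ) (D.ne_one_of_mem hH) fun _ => rfl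
    obtain ⟨B, hB⟩ := hmul (fun θ => (θ : D.Theta)⁻¹)
      (fun θ => inv_ne_one.2 (D.ne_one_of_mem hH θ)) fun θ => D.primeFactor_inv θ z 1
    -- With both halves known to converge, their value may be read off by multiplying the terms of
    -- `θ` and `θ⁻¹`.
    have hAB : A * B = (Q / R) / (Q₁ / R₁) := by
      refine (hA.mul hB).unique ?_
      refine Eq.subst (motive := fun F => HasProd F ((Q / R) / (Q₁ / R₁))) (funext fun θ => ?_)
        ((hQ.div₀ hR hR0).div₀ (hQ₁.div₀ hR₁ hR₁0) (div_ne_zero hQ₁0 hR₁0))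
      obtain ⟨a, b, c, d, hM⟩ := D.exists_isMobius (θ : D.Theta).2
      have hθ := D.ne_one_of_mem hH θ
      refine (hM.blaschke_div_mul_inv hp0 (D.apply_ne_of_mem_double hθ hzd hzd)
        (D.apply_ne_of_mem_double hθ h1d h1d) (D.apply_ne_of_mem_double hθ hpd hpd)
        (D.apply_ne_of_mem_double hθ hsd hsd)).symm
    have hall := D.hasProd_half hH hA hB
    -- The identity contributes exactly the prefactors `z - y` of the four prime functions.
    have hf1 : f 1 = ((z - p) / (z - (conj p)⁻¹)) / ((1 - p) / (1 - (conj p)⁻¹)) := by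
      have := IsMobius.one.blaschke_div z p hp0
      simp only [zero_mul, zero_add, mul_one, one_mul, add_zero] at this
      rw [hf]
      refine Eq.trans this ?_
      rw [← neg_sub p z, ← neg_sub (conj p)⁻¹ z, neg_div_neg_eq, ← neg_sub p 1,
        ← neg_sub (conj p)⁻¹ 1, neg_div_neg_eq]
    convert hall using 1
    rw [hAB, hf1, slitMap, slitMap, eQ, eR, eQ₁, eR₁]
    have k1 := sub_ne_zero.2 h1p
    have k2 := sub_ne_zero.2 h1s
    have k3 := sub_ne_zero.2 hzs
    generalize (conj p)⁻¹ = s at *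
    field_simp
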